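/- For a positive integer $N$ write $\mathbb{Z}_N=\mathbb{Z}/N\mathbb{Z}$. Two nonempty subsets $S,T\subseteq\mathbb{Z}_N$ are called formally dual if for every $y\in\mathbb{Z}_N$ $$\Bigl|\frac{1}{|S|}\sum_{x\in S}e^{2\pi i xy/N}\Bigr|^2=\frac{1}{|T|}\,\#\{(t,t')\in T\times T: t-t'=y\},$$ and a subset of $\mathbb{Z}_N$ is called primitive if it is not contained in a coset of a proper subgroup of $\mathbb{Z}_N$. Let $p,q$ be distinct primes, let $a\ge 0$ be an integer and let $N=p^aq$. Then there are no formally dual subsets $S,T\subseteq\mathbb{Z}_N$ that are both primitive. -/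

import Mathlib

open scoped Pointwise

/-- A subset `T` of an abelian group is primitive if it is not contained in a coset of a
proper subgroup. -/
def IsPrimitiveSubset {G : Type*} [AddCommGroup G] (T : Finset G) : Prop :=
  ∀ H : AddSubgroup G, H ≠ ⊤ → ∀ g : G, ¬ ((T : Set G) ⊆ g +ᵥ (H : Set G))

/-- The weight enumerator of `T`: the number of pairs `(t, t') ∈ T × T` with `t - t' = y`. -/
def weightEnumerator {G : Type*} [AddCommGroup G] [DecidableEq G] (T : Finset G) (y : G) : ℕ :=
  ((T ×ˢ T).filter fun r => r.1 - r.2 = y).card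

/-- Formal duality of `S, T ⊆ ℤ/N`, where the dual group of `ℤ/N` is identified with `ℤ/N` by
letting `y` correspond to the character `x ↦ exp (2πi x y / N)`:
`|(1/|S|) ∑_{x ∈ S} exp (2πi x y / N)|² = ν_T(y) / |T|` for every `y`. -/
def AreFormallyDual {N : ℕ} [NeZero N] (S T : Finset (ZMod N)) : Prop :=
  ∀ y : ZMod N,
    ‖(1 / (S.card : ℂ)) * ∑ x ∈ S, ZMod.stdAddChar (x * y)‖ ^ 2
      = (1 / (T.card : ℝ)) * (weightEnumerator T y : ℝ)

open Finset

/-! Fourier inversion makes duality symmetric and gives `|S| * |T| = N`, so exactly one size, say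
`|S|`, is divisible by `q`. For `a > 0`, primitivity makes some unit a difference in each set, and
Galois conjugation then makes every unit one. Integrality of the character sums forces `q ∣ ν_S(u)`,
so each unit `u` occurs at least `q` times in `S` and once in `T`. Unit differences are nonzero mod
`p` and mod `q`, and Cauchy–Schwarz bounds the number of such pairs. The resulting lower bounds on
`|S|` and `|T|` contradict `|S| * |T| = N`. -/

theorem sum_weightEnumerator_eq {G : Type*} [AddCommGroup G] [Fintype G] [DecidableEq G]
    (T : Finset G) {M : Type*} [CommSemiring M] (f : G → M) :
    ∑ y, (weightEnumerator T y : M) * f y = ∑ r ∈ T ×ˢ T, f (r.1 - r.2) := by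
  rw [← Finset.sum_fiberwise (T ×ˢ T) (fun r => r.1 - r.2)]
  refine Finset.sum_congr rfl fun y _ => ?_
  rw [Finset.sum_congr rfl (g := fun _ => f y), Finset.sum_const, nsmul_eq_mul, weightEnumerator]
  intro r hr
  rw [(Finset.mem_filter.mp hr).2]

theorem weightEnumerator_zero {G : Type*} [AddCommGroup G] [DecidableEq G] (T : Finset G) :
    weightEnumerator T 0 = T.card := by
  rw [weightEnumerator, ← Finset.diag_card T]
  congr 1
  ext ⟨x, y⟩
  simp only [mem_filter, mem_product, mem_diag, sub_eq_zero]
  constructor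
  · rintro ⟨⟨h, -⟩, h'⟩; exact ⟨h, h'⟩
  · rintro ⟨h, rfl⟩; exact ⟨⟨h, h⟩, rfl⟩

theorem weightEnumerator_pos_iff {G : Type*} [AddCommGroup G] [DecidableEq G] {T : Finset G}
    {y : G} : 0 < weightEnumerator T y ↔ ∃ t ∈ T, ∃ t' ∈ T, t - t' = y := by
  rw [weightEnumerator, Finset.card_pos]
  constructor
  · rintro ⟨⟨t, t'⟩, h⟩
    simp only [mem_filter, mem_product] at h
    exact ⟨t, h.1.1, t', h.1.2, h.2⟩
  · rintro ⟨t, ht, t', ht', h⟩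
    exact ⟨(t, t'), by simp [ht, ht', h]⟩

theorem IsPrimitiveSubset.exists_map_ne {G A : Type*} [AddCommGroup G] [AddCommGroup A]
    {T : Finset G} (hT : IsPrimitiveSubset T) (f : G →+ A) (hf : f ≠ 0) (t : G) :
    ∃ t' ∈ T, f t' ≠ f t := by
  by_contra! h
  refine hT f.ker (fun h => hf ?_) t fun x hx => ?_
  · ext x
    exact (f.mem_ker).mp (h ▸ AddSubgroup.mem_top x)
  · rw [Set.mem_vadd_set_iff_neg_vadd_mem]
    simp [AddMonoidHom.mem_ker, h x hx]

theorem IsPrimitiveSubset.nonempty {G : Type*} [AddCommGroup G] [Nontrivial G]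
    {T : Finset G} (hT : IsPrimitiveSubset T) : T.Nonempty := by
  rw [Finset.nonempty_iff_ne_empty]
  rintro rfl
  exact hT ⊥ bot_ne_top 0 (by simp)

theorem IsPrimitiveSubset.card_ne_one {G : Type*} [AddCommGroup G] [Nontrivial G]
    {T : Finset G} (hT : IsPrimitiveSubset T) : T.card ≠ 1 := by
  intro h
  obtain ⟨x, rfl⟩ := Finset.card_eq_one.mp h
  refine hT ⊥ bot_ne_top x ?_
  simp

/-- Some pair of points of a primitive set is separated by both of two given nonzero
homomorphisms. -/
theorem IsPrimitiveSubset.exists_map_ne_map_ne {G A B : Type*} [AddCommGroup G] [AddCommGroup A]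
    [AddCommGroup B] {T : Finset G} (hT : IsPrimitiveSubset T) (f : G →+ A) (g : G →+ B)
    (hf : f ≠ 0) (hg : g ≠ 0) : ∃ t ∈ T, ∃ t' ∈ T, f t ≠ f t' ∧ g t ≠ g t' := by
  obtain ⟨t₁, h₁, -⟩ := hT.exists_map_ne f hf 0
  obtain ⟨t₂, h₂, hf₂⟩ := hT.exists_map_ne f hf t₁
  obtain ⟨t₃, h₃, hg₃⟩ := hT.exists_map_ne g hg t₁
  by_cases hg₂ : g t₂ = g t₁
  · by_cases hf₃ : f t₃ = f t₁
    · exact ⟨t₂, h₂, t₃, h₃, by rwa [hf₃], by rw [hg₂]; exact hg₃.symm⟩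
    · exact ⟨t₃, h₃, t₁, h₁, hf₃, hg₃⟩
  · exact ⟨t₂, h₂, t₁, h₁, hf₂, hg₂⟩

/-- At most a proportion `1 - 1/|A|` of the pairs of points is separated by a map to `A`. -/
theorem card_mul_card_filter_ne_le {α A : Type*} [Fintype A] [DecidableEq A] (T : Finset α)
    (f : α → A) :
    Fintype.card A * ((T ×ˢ T).filter fun r => f r.1 ≠ f r.2).card
      ≤ T.card ^ 2 * (Fintype.card A - 1) := by
  have h1 : ((T ×ˢ T).filter fun r => f r.1 = f r.2).card
      = ∑ c : A, ((T.filter fun t => f t = c).card) ^ 2 := by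
    rw [Finset.card_eq_sum_card_fiberwise (f := fun r => f r.1) (t := Finset.univ) (by simp)]
    refine Finset.sum_congr rfl fun c _ => ?_
    rw [sq, ← Finset.card_product]
    congr 1
    ext ⟨x, y⟩
    simp only [mem_filter, mem_product]
    constructor
    · rintro ⟨⟨⟨h, h'⟩, e⟩, e'⟩; exact ⟨⟨h, e'⟩, h', e ▸ e'⟩
    · rintro ⟨⟨h, e⟩, h', e'⟩; exact ⟨⟨⟨h, h'⟩, e.trans e'.symm⟩, e⟩
  have h2 : T.card = ∑ c : A, (T.filter fun t => f t = c).card :=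
    Finset.card_eq_sum_card_fiberwise (by simp)
  -- Cauchy–Schwarz on the fibre sizes.
  have h3 := sq_sum_le_card_mul_sum_sq (s := (Finset.univ : Finset A))
    (f := fun c => (T.filter fun t => f t = c).card)
  rw [← h1, ← h2, Finset.card_univ] at h3
  have h4 := Finset.card_filter_add_card_filter_not (s := T ×ˢ T) (fun r => f r.1 = f r.2)
  rw [Finset.card_product, ← sq] at h4
  rw [Nat.mul_sub, mul_one]
  apply Nat.le_sub_of_add_le
  nlinarith

/-! ### Fourier inversion and symmetry of duality -/

theorem ZMod.normSq_sum_stdAddChar {N : ℕ} [NeZero N] (S : Finset (ZMod N)) (y : ZMod N) :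
    ((‖∑ x ∈ S, ZMod.stdAddChar (x * y)‖ ^ 2 : ℝ) : ℂ)
      = ∑ r ∈ S ×ˢ S, ZMod.stdAddChar ((r.1 - r.2) * y) := by
  push_cast
  rw [← Complex.mul_conj', map_sum, Finset.sum_mul_sum, Finset.sum_product]
  refine Finset.sum_congr rfl fun x _ => Finset.sum_congr rfl fun x' _ => ?_
  rw [← AddChar.map_neg_eq_conj, ← AddChar.map_add_eq_mul]
  congr 1
  ring

theorem AreFormallyDual.normSq_eq {N : ℕ} [NeZero N] {S T : Finset (ZMod N)}
    (h : AreFormallyDual S T) (hS : S.Nonempty) (y : ZMod N) :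
    ‖∑ x ∈ S, ZMod.stdAddChar (x * y)‖ ^ 2
      = (S.card : ℝ) ^ 2 / T.card * weightEnumerator T y := by
  have hS' : (S.card : ℝ) ≠ 0 := by exact_mod_cast hS.card_pos.ne'
  have := h y
  rw [norm_mul, mul_pow, norm_div, norm_one, Complex.norm_natCast] at this
  field_simp at this ⊢
  rw [this]

theorem AreFormallyDual.inversion {N : ℕ} [NeZero N] {S T : Finset (ZMod N)}
    (h : AreFormallyDual S T) (hS : S.Nonempty) (w : ZMod N) :
    (S.card : ℝ) ^ 2 / T.card * ‖∑ x ∈ T, ZMod.stdAddChar (x * w)‖ ^ 2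
      = N * weightEnumerator S w := by
  have key : ∑ y, (((‖∑ x ∈ S, ZMod.stdAddChar (x * y)‖ ^ 2 : ℝ) : ℂ)) * ZMod.stdAddChar (y * w)
      = N * weightEnumerator S (-w) := by
    simp_rw [ZMod.normSq_sum_stdAddChar, fun y : ZMod N =>
      (sum_weightEnumerator_eq S fun z => (ZMod.stdAddChar (z * y) : ℂ)).symm, Finset.sum_mul]
    rw [Finset.sum_comm]
    have (z : ZMod N) : ∑ y, ((weightEnumerator S z : ℂ) * ZMod.stdAddChar (z * y))
        * ZMod.stdAddChar (y * w) = if z = -w then (N * weightEnumerator S (-w) : ℂ) else 0 := by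
      simp_rw [mul_assoc, ← AddChar.map_add_eq_mul]
      rw [← Finset.mul_sum]
      have e (y : ZMod N) : z * y + y * w = y * (z + w) := by ring
      simp_rw [e, AddChar.sum_mulShift _ (ZMod.isPrimitive_stdAddChar N), add_eq_zero_iff_eq_neg,
        ZMod.card]
      split_ifs with hz
      · rw [hz, mul_comm]
      · simp
    simp_rw [this]
    simp
  have hneg : weightEnumerator S (-w) = weightEnumerator S w := by
    rw [weightEnumerator, weightEnumerator]
    refine Finset.card_bij (fun r _ => (r.2, r.1)) ?_ ?_ ?_
    · rintro ⟨x, y⟩ hr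
      simp only [mem_filter, mem_product] at hr ⊢
      exact ⟨hr.1.symm, by rw [← neg_sub, hr.2, neg_neg]⟩
    · rintro ⟨x, y⟩ _ ⟨x', y'⟩ _ e
      simp_all
    · rintro ⟨x, y⟩ hr
      simp only [mem_filter, mem_product] at hr
      exact ⟨(y, x), by simp [hr.1, ← hr.2], rfl⟩
  simp_rw [h.normSq_eq hS] at key
  rw [hneg] at key
  have : ((((S.card : ℝ) ^ 2 / T.card * ‖∑ x ∈ T, ZMod.stdAddChar (x * w)‖ ^ 2 : ℝ)) : ℂ)
      = ((N * weightEnumerator S w : ℝ) : ℂ) := by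
    rw [Complex.ofReal_mul, ZMod.normSq_sum_stdAddChar, 
      ← sum_weightEnumerator_eq T fun z => (ZMod.stdAddChar (z * w) : ℂ), Finset.mul_sum]
    push_cast at key ⊢
    rw [← key]
    exact Finset.sum_congr rfl fun y _ => by ring
  exact_mod_cast this

theorem AreFormallyDual.card_mul_card {N : ℕ} [NeZero N] {S T : Finset (ZMod N)}
    (h : AreFormallyDual S T) (hS : S.Nonempty) (hT : T.Nonempty) : S.card * T.card = N := by
  have := h.inversion hS 0
  have hS' : (S.card : ℝ) ≠ 0 := by exact_mod_cast hS.card_pos.ne'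
  have hT' : (T.card : ℝ) ≠ 0 := by exact_mod_cast hT.card_pos.ne'
  simp only [mul_zero, AddChar.map_zero_eq_one, sum_const, nsmul_eq_mul, mul_one,
    Complex.norm_natCast, weightEnumerator_zero] at this
  field_simp at this
  exact_mod_cast this

theorem AreFormallyDual.symm {N : ℕ} [NeZero N] {S T : Finset (ZMod N)}
    (h : AreFormallyDual S T) (hS : S.Nonempty) (hT : T.Nonempty) : AreFormallyDual T S := by
  intro y
  have := h.inversion hS y
  have hS' : (S.card : ℝ) ≠ 0 := by exact_mod_cast hS.card_pos.ne'
  have hT' : (T.card : ℝ) ≠ 0 := by exact_mod_cast hT.card_pos.ne'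
  have hN : (N : ℝ) = S.card * T.card := by exact_mod_cast (h.card_mul_card hS hT).symm
  rw [hN] at this
  rw [norm_mul, mul_pow, norm_div, norm_one, Complex.norm_natCast]
  field_simp at this ⊢
  linarith

/-! ### Galois conjugation and integrality -/

theorem ZMod.sum_stdAddChar_eq_aeval {N : ℕ} [NeZero N] (S : Finset (ZMod N)) (y : ZMod N) :
    ∑ x ∈ S, (ZMod.stdAddChar (x * y) : ℂ)
      = Polynomial.aeval (ZMod.stdAddChar y : ℂ) (∑ x ∈ S, (Polynomial.X : Polynomial ℚ) ^ x.val) := by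
  simp only [map_sum, map_pow, Polynomial.aeval_X]
  refine Finset.sum_congr rfl fun x _ => ?_
  rw [← AddChar.map_nsmul_eq_pow, nsmul_eq_mul, ZMod.natCast_zmod_val]

theorem ZMod.isPrimitiveRoot_stdAddChar {N : ℕ} [NeZero N] {y : ZMod N} (hy : IsUnit y) :
    IsPrimitiveRoot (ZMod.stdAddChar y : ℂ) N := by
  refine (IsPrimitiveRoot.iff_def _ _).mpr ⟨?_, fun l hl => ?_⟩
  · rw [← AddChar.map_nsmul_eq_pow]; simp
  · rw [← AddChar.map_nsmul_eq_pow, ← AddChar.map_zero_eq_one (ZMod.stdAddChar (N := N))] at hl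
    have := ZMod.injective_stdAddChar hl
    rw [nsmul_eq_mul, hy.mul_left_eq_zero] at this
    exact (ZMod.natCast_eq_zero_iff _ _).mp this

/-- All primitive `N`-th roots of unity have the same minimal polynomial over `ℚ`. -/
theorem ZMod.sum_stdAddChar_eq_zero_of_isUnit {N : ℕ} [NeZero N] {S : Finset (ZMod N)}
    {y z : ZMod N} (hy : IsUnit y) (hz : IsUnit z)
    (h : ∑ x ∈ S, (ZMod.stdAddChar (x * y) : ℂ) = 0) :
    ∑ x ∈ S, (ZMod.stdAddChar (x * z) : ℂ) = 0 := by
  have hN := NeZero.pos N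
  rw [ZMod.sum_stdAddChar_eq_aeval] at h ⊢
  have h1 := minpoly.dvd ℚ _ h
  rw [← Polynomial.cyclotomic_eq_minpoly_rat (ZMod.isPrimitiveRoot_stdAddChar hy) hN,
    Polynomial.cyclotomic_eq_minpoly_rat (ZMod.isPrimitiveRoot_stdAddChar hz) hN] at h1
  obtain ⟨c, hc⟩ := h1
  rw [hc, map_mul, minpoly.aeval, zero_mul]

theorem AreFormallyDual.weightEnumerator_pos_of_isUnit {N : ℕ} [NeZero N] {S T : Finset (ZMod N)}
    (h : AreFormallyDual S T) (hS : S.Nonempty) (hT : T.Nonempty) {y z : ZMod N}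
    (hy : IsUnit y) (hz : IsUnit z) (hpos : 0 < weightEnumerator T y) :
    0 < weightEnumerator T z := by
  by_contra h0
  have hS' : (S.card : ℝ) ≠ 0 := by exact_mod_cast hS.card_pos.ne'
  have hT' : (T.card : ℝ) ≠ 0 := by exact_mod_cast hT.card_pos.ne'
  have h1 := h.normSq_eq hS z
  rw [Nat.eq_zero_of_not_pos h0, Nat.cast_zero, mul_zero, sq_eq_zero_iff, norm_eq_zero] at h1
  have h2 := h.normSq_eq hS y
  rw [ZMod.sum_stdAddChar_eq_zero_of_isUnit hz hy h1, norm_zero] at h2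
  have : (weightEnumerator T y : ℝ) ≠ 0 := by exact_mod_cast hpos.ne'
  have : (S.card : ℝ) ^ 2 / T.card * weightEnumerator T y ≠ 0 := by positivity
  exact this (by rw [← h2]; norm_num)

/-- The squared modulus of the character sum is an algebraic integer, and rational by duality, hence
an integer. -/
theorem AreFormallyDual.card_dvd {N : ℕ} [NeZero N] {S T : Finset (ZMod N)}
    (h : AreFormallyDual S T) (hS : S.Nonempty) (hT : T.Nonempty) (y : ZMod N) :
    T.card ∣ S.card ^ 2 * weightEnumerator T y := by
  have h1 := congrArg (fun r : ℝ => (r : ℂ)) (h.normSq_eq hS y)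
  simp only [ZMod.normSq_sum_stdAddChar] at h1
  have hint : IsIntegral ℤ (∑ r ∈ S ×ˢ S, (ZMod.stdAddChar ((r.1 - r.2) * y) : ℂ)) := by
    refine IsIntegral.sum _ fun r _ => ?_
    refine IsIntegral.of_pow (NeZero.pos N) ?_
    rw [← AddChar.map_nsmul_eq_pow]
    simpa using isIntegral_one
  have h2 : (((S.card : ℝ) ^ 2 / T.card * weightEnumerator T y : ℝ) : ℂ)
      = algebraMap ℚ ℂ ((S.card : ℚ) ^ 2 / T.card * weightEnumerator T y) := by
    simp
  rw [h1, h2, isIntegral_algebraMap_iff (algebraMap ℚ ℂ).injective,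
    IsIntegrallyClosed.isIntegral_iff] at hint
  obtain ⟨k, hk⟩ := hint
  have hT' : (T.card : ℚ) ≠ 0 := by exact_mod_cast hT.card_pos.ne'
  simp only [algebraMap_int_eq, eq_intCast] at hk
  field_simp at hk
  have h3 : ((S.card ^ 2 * weightEnumerator T y : ℕ) : ℤ) = T.card * k := by
    have : (((S.card ^ 2 * weightEnumerator T y : ℕ) : ℤ) : ℚ) = ((T.card * k : ℤ) : ℚ) := by
      push_cast; linarith
    exact_mod_cast this
  exact Int.natCast_dvd_natCast.mp ⟨k, h3⟩

/-- If every unit occurs at least `c` times as a difference of `T`, then `T` is large. -/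
theorem mul_totient_mul_le_of_le_weightEnumerator {N r c : ℕ} [NeZero N] [Fact r.Prime]
    (hr : r ∣ N) (T : Finset (ZMod N)) (hc : ∀ y, IsUnit y → c ≤ weightEnumerator T y) :
    r * (c * N.totient) ≤ T.card ^ 2 * (r - 1) := by
  have h1 := card_mul_card_filter_ne_le T (ZMod.castHom hr (ZMod r))
  rw [ZMod.card] at h1
  refine (Nat.mul_le_mul_left r ?_).trans h1
  rw [← ZMod.card_units_eq_totient, mul_comm, ← smul_eq_mul, ← Finset.card_univ,
    ← Finset.sum_const]
  calc ∑ _u : (ZMod N)ˣ, c ≤ ∑ u : (ZMod N)ˣ, weightEnumerator T (u : ZMod N) :=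
        Finset.sum_le_sum fun u _ => hc u u.isUnit
    _ = ((Finset.univ : Finset (ZMod N)ˣ).biUnion fun u =>
          (T ×ˢ T).filter fun s => s.1 - s.2 = (u : ZMod N)).card := by
        rw [Finset.card_biUnion]
        · simp only [weightEnumerator]
        · intro u _ v _ huv
          refine Finset.disjoint_left.mpr fun r hu hv => huv (Units.ext ?_)
          rw [← (mem_filter.mp hu).2, (mem_filter.mp hv).2]
    _ ≤ _ := by
        refine Finset.card_le_card fun s hs => ?_
        simp only [mem_biUnion, mem_filter, mem_univ, true_and] at hs ⊢
        obtain ⟨u, hs, hu⟩ := hs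
        refine ⟨hs, fun e => ?_⟩
        have := u.isUnit.map (ZMod.castHom hr (ZMod r))
        rw [← hu, map_sub, e, sub_self] at this
        exact not_isUnit_zero this

/-- Units are the residues nonzero mod `p` and mod `q`, so a pair separated by both reductions
suffices. -/
theorem IsPrimitiveSubset.exists_isUnit_weightEnumerator_pos {p q a N : ℕ} [NeZero N]
    (hp : p.Prime) (hq : q.Prime) (ha : a ≠ 0) (hN : N = p ^ a * q) {T : Finset (ZMod N)}
    (hT : IsPrimitiveSubset T) : ∃ y, IsUnit y ∧ 0 < weightEnumerator T y := by
  have : Fact p.Prime := ⟨hp⟩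
  have : Fact q.Prime := ⟨hq⟩
  have hpN : p ∣ N := hN ▸ (dvd_pow_self p ha).mul_right q
  have hqN : q ∣ N := hN ▸ dvd_mul_left q _
  have ne {r : ℕ} [Fact r.Prime] (hr : r ∣ N) :
      (ZMod.castHom hr (ZMod r)).toAddMonoidHom ≠ 0 := fun e => by
    have : ZMod.castHom hr (ZMod r) 1 = 0 := DFunLike.congr_fun e 1
    rw [map_one] at this
    exact one_ne_zero this
  obtain ⟨t, ht, t', ht', h1, h2⟩ := hT.exists_map_ne_map_ne _ _ (ne hpN) (ne hqN)
  refine ⟨t - t', ?_, weightEnumerator_pos_iff.mpr ⟨t, ht, t', ht', rfl⟩⟩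
  have cop {r : ℕ} [hF : Fact r.Prime] (hr : r ∣ N)
      (h : ZMod.castHom hr (ZMod r) t ≠ ZMod.castHom hr (ZMod r) t') :
      (t - t').val.Coprime r := by
    rw [Nat.coprime_comm, hF.out.coprime_iff_not_dvd, ← ZMod.natCast_eq_zero_iff]
    rw [← sub_ne_zero, ← map_sub, ← ZMod.natCast_zmod_val (t - t'), map_natCast] at h
    exact h
  rw [← ZMod.natCast_zmod_val (t - t'), ZMod.isUnit_iff_coprime]
  refine Nat.Coprime.of_dvd_right hN.dvd ?_
  exact ((cop hpN h1).pow_right a).mul_right (cop hqN h2)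

theorem card_inequalities_false {p q a m n N : ℕ} (hp : p.Prime) (hq : q.Prime) (hpq : p ≠ q)
    (hN : N = p ^ (a + 1) * q) (hmn : m * n = N) (hn : q.Coprime n)
    (h1 : p * (1 * N.totient) ≤ n ^ 2 * (p - 1))
    (h2 : q * (1 * N.totient) ≤ n ^ 2 * (q - 1))
    (h3 : p * (q * N.totient) ≤ m ^ 2 * (p - 1)) : False := by
  subst hN
  have hcop : (p ^ (a + 1)).Coprime q := ((Nat.coprime_primes hp hq).mpr hpq).pow_left _
  rw [Nat.totient_mul hcop, Nat.totient_prime_pow_succ hp, Nat.totient_prime hq] at h1 h2 h3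
  obtain ⟨P, rfl⟩ : ∃ P, p = P + 1 := ⟨p - 1, by have := hp.pos; omega⟩
  obtain ⟨Q, rfl⟩ : ∃ Q, q = Q + 1 := ⟨q - 1, by have := hq.pos; omega⟩
  have hP : 0 < P := by have := hp.two_le; omega
  have hQ : 0 < Q := by have := hq.two_le; omega
  simp only [Nat.add_sub_cancel] at h1 h2 h3
  have h1' : (P + 1) ^ (a + 1) * Q ≤ n ^ 2 := by
    refine Nat.le_of_mul_le_mul_right (le_trans (le_of_eq ?_) h1) hP
    ring
  have h2' : (Q + 1) * ((P + 1) ^ a * P) ≤ n ^ 2 := by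
    refine Nat.le_of_mul_le_mul_right (le_trans (le_of_eq ?_) h2) hQ
    ring
  have h3' : (P + 1) ^ (a + 1) * (Q * (Q + 1)) ≤ m ^ 2 := by
    refine Nat.le_of_mul_le_mul_right (le_trans (le_of_eq ?_) h3) hP
    ring
  -- The product of `h1'` and `h3'` gives `(q - 1)² ≤ q`, forcing `q = 2`.
  have h4 : Q * Q ≤ Q + 1 := by
    have hc : 0 < ((P + 1) ^ (a + 1)) ^ 2 * (Q + 1) := by positivity
    refine Nat.le_of_mul_le_mul_left ?_ hc
    calc _ = (P + 1) ^ (a + 1) * Q * ((P + 1) ^ (a + 1) * (Q * (Q + 1))) := by ring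
      _ ≤ n ^ 2 * m ^ 2 := Nat.mul_le_mul h1' h3'
      _ = (m * n) ^ 2 := by ring
      _ = _ := by rw [hmn]; ring
  have hQ1 : Q = 1 := by nlinarith
  subst hQ1
  have hP2 : 2 ≤ P := by omega
  obtain ⟨k, hk, rfl⟩ : ∃ k ≤ a + 1, n = (P + 1) ^ k := by
    refine (Nat.dvd_prime_pow hp).mp (hn.symm.dvd_of_dvd_mul_right (n := 1 + 1) ?_)
    exact hmn ▸ dvd_mul_left n m
  have hkpos : 0 < (P + 1) ^ k := by positivity
  -- The lower bound `h3'` on `m` is an upper bound on `n = N / m`.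
  have h5 : ((P + 1) ^ k) ^ 2 ≤ (P + 1) ^ (a + 1) * 2 := by
    have h6 : (P + 1) ^ (a + 1) * 2 * ((P + 1) ^ k) ^ 2
        ≤ (P + 1) ^ (a + 1) * 2 * ((P + 1) ^ (a + 1) * 2) := by
      calc _ = (P + 1) ^ (a + 1) * (1 * (1 + 1)) * ((P + 1) ^ k) ^ 2 := by ring
        _ ≤ m ^ 2 * ((P + 1) ^ k) ^ 2 := Nat.mul_le_mul_right _ h3'
        _ = (m * (P + 1) ^ k) ^ 2 := by ring
        _ = _ := by rw [hmn]; ring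
    exact Nat.le_of_mul_le_mul_left h6 (by positivity)
  rw [← pow_mul] at h1' h2' h5
  -- As `p > 2`, the factor 2 in `h5` cannot absorb another power of `p`.
  have h6 : k * 2 < a + 2 := by
    by_contra! h
    have := Nat.pow_le_pow_right (Nat.succ_pos P) h
    have e : (P + 1) ^ (a + 2) = (P + 1) ^ (a + 1) * (P + 1) := by ring
    have := Nat.mul_lt_mul_of_pos_left (show 2 < P + 1 by omega)
      (show 0 < (P + 1) ^ (a + 1) by positivity)
    simp only [Nat.succ_eq_add_one] at *
    omega
  have h7 : (P + 1) ^ (k * 2) ≤ (P + 1) ^ (a + 1) :=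
    Nat.pow_le_pow_right (Nat.succ_pos P) (by omega)
  -- This says `2 * (p - 1) ≤ p`, impossible for `p ≥ 3`.
  have h8 : (P + 1) ^ a * (2 * P) ≤ (P + 1) ^ a * (P + 1) := by
    calc _ = (1 + 1) * ((P + 1) ^ a * P) := by ring
      _ ≤ _ := h2'.trans h7
      _ = _ := by ring
  have := Nat.le_of_mul_le_mul_left h8 (by positivity)
  omega

theorem AreFormallyDual.false_of_coprime_card {p q a N : ℕ} [NeZero N] (hp : p.Prime)
    (hq : q.Prime) (hpq : p ≠ q) (hN : N = p ^ a * q) {S T : Finset (ZMod N)}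
    (h : AreFormallyDual S T) (hS : IsPrimitiveSubset S) (hT : IsPrimitiveSubset T)
    (hqT : q.Coprime T.card) : False := by
  have : Fact p.Prime := ⟨hp⟩
  have : Fact q.Prime := ⟨hq⟩
  have hqN : q ∣ N := hN ▸ dvd_mul_left q _
  have : Fact (1 < N) := ⟨hq.one_lt.trans_le (Nat.le_of_dvd (NeZero.pos N) hqN)⟩
  have hS0 := hS.nonempty
  have hT0 := hT.nonempty
  have hmn := h.card_mul_card hS0 hT0
  -- For `a = 0`, `|T|` divides `q` and is coprime to it, so `T` is a single point.
  rcases a with _ | a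
  · refine hT.card_ne_one (Nat.Coprime.eq_one_of_dvd hqT.symm ⟨S.card, ?_⟩)
    rw [mul_comm, hmn, hN, pow_zero, one_mul]
  have hpN : p ∣ N := hN ▸ (dvd_pow_self p a.succ_ne_zero).mul_right q
  have hqS : q ∣ S.card := hqT.dvd_of_dvd_mul_right (hqN.trans hmn.symm.dvd)
  have h' := h.symm hS0 hT0
  obtain ⟨y, hy, hyT⟩ := hT.exists_isUnit_weightEnumerator_pos hp hq a.succ_ne_zero hN
  obtain ⟨z, hz, hzS⟩ := hS.exists_isUnit_weightEnumerator_pos hp hq a.succ_ne_zero hN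
  have hcT (u : ZMod N) (hu : IsUnit u) : 1 ≤ weightEnumerator T u :=
    h.weightEnumerator_pos_of_isUnit hS0 hT0 hy hu hyT
  have hcS (u : ZMod N) (hu : IsUnit u) : q ≤ weightEnumerator S u :=
    Nat.le_of_dvd (h'.weightEnumerator_pos_of_isUnit hT0 hS0 hz hu hzS)
      ((hqT.pow_right 2).dvd_of_dvd_mul_left (hqS.trans (h'.card_dvd hT0 hS0 u)))
  have h1 := mul_totient_mul_le_of_le_weightEnumerator hpN T hcT
  have h2 := mul_totient_mul_le_of_le_weightEnumerator hqN T hcT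
  have h3 := mul_totient_mul_le_of_le_weightEnumerator hpN S hcS
  exact card_inequalities_false hp hq hpq hN hmn hqT h1 h2 h3

theorem mainTheorem4 (p q : ℕ) (hp : p.Prime) (hq : q.Prime) (hpq : p ≠ q) (a N : ℕ) [NeZero N]
    (hN : N = p ^ a * q) :
    ¬ ∃ S T : Finset (ZMod N),
        AreFormallyDual S T ∧ IsPrimitiveSubset S ∧ IsPrimitiveSubset T := by
  rintro ⟨S, T, h, hS, hT⟩
  have hqN : q ∣ N := hN ▸ dvd_mul_left q _
  have : Fact (1 < N) := ⟨hq.one_lt.trans_le (Nat.le_of_dvd (NeZero.pos N) hqN)⟩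
  have hmn := h.card_mul_card hS.nonempty hT.nonempty
  -- Since `q² ∤ N`, `q` misses one of the two sizes; symmetry lets that set play the role of `T`.
  by_cases hqT : q ∣ T.card
  · refine (h.symm hS.nonempty hT.nonempty).false_of_coprime_card hp hq hpq hN hT hS ?_
    rw [hq.coprime_iff_not_dvd]
    intro hqS
    have h1 : q * q ∣ p ^ a * q := hN ▸ hmn ▸ mul_dvd_mul hqS hqT
    have h2 := hq.dvd_of_dvd_pow (Nat.dvd_of_mul_dvd_mul_right hq.pos h1)
    exact hpq ((Nat.prime_dvd_prime_iff_eq hq hp).mp h2).symm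
  · exact h.false_of_coprime_card hp hq hpq hN hS hT (hq.coprime_iff_not_dvd.mpr hqT)
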